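/- There is an absolute constant $C$ with the following property. Let $G=(V,E)$ be a finite connected undirected graph with positive real edge weights, let $N=|V|$, let $\alpha$ be the treewidth of $G$, and regard $V$ as a metric space with the shortest-path distance. Let $1\le k<N$ and let $x_0\in V^k$ be arbitrary initial positions of $k$ servers. Each request names a vertex; after it has been answered, some server has to be at that vertex; the cost is the total distance moved by all servers. Then there is a deterministic online algorithm with advice for the $k$-server problem on $G$ (it may depend on $G$, its weights, $k$ and $x_0$) such that for every $n\ge 0$ and every request sequence $\sigma=(r_1,\dots,r_n)$ there is an infinite bit string $B$ (the advice tape) for which the following holds. With tape $B$, the algorithm serves $\sigma$ at a cost equal to the minimum cost of serving $\sigma$ from $x_0$, and while doing so it reads at most $$C\,n\,(\log_2\alpha+\log_2\log_2 N)$$ bits of $B$. Here an online algorithm with advice reads the tape sequentially from its beginning; at each request it reads some number of further bits (possibly none) and then moves its servers, and all its decisions (to read on, or how to move) at the $i$-th request are functions of $r_1,\dots,r_i$ and of the bits read so far. -/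

import Mathlib

namespace KServer

/-- A finite tree decomposition of `G` (the tree is not rooted here, since a choice of
root has no influence on the width). -/
structure TreeDecomposition {V : Type*} (G : SimpleGraph V) where
  /-- the number of nodes of the tree -/
  size : ℕ
  tree : SimpleGraph (Fin size)
  isTree : tree.IsTree
  bag : Fin size → Finset V
  vertex_mem : ∀ v : V, ∃ i, v ∈ bag i
  edge_mem : ∀ v w : V, G.Adj v w → ∃ i, v ∈ bag i ∧ w ∈ bag i
  /-- a vertex in two bags lies in every bag on the path between them -/
  path_mem : ∀ (i j l : Fin size) (q : tree.Walk i l), q.IsPath → j ∈ q.support →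
    ∀ v, v ∈ bag i → v ∈ bag l → v ∈ bag j

/-- The width of `D` is `a`: the largest bag has `a + 1` elements. -/
def TreeDecomposition.HasWidth {V : Type*} {G : SimpleGraph V}
    (D : TreeDecomposition G) (a : ℕ) : Prop :=
  (Finset.univ.sup fun i => (D.bag i).card) = a + 1

/-- The minimum width of a tree decomposition. -/
noncomputable def treewidth {V : Type*} (G : SimpleGraph V) : ℕ :=
  sInf {a : ℕ | ∃ D : TreeDecomposition G, D.HasWidth a}

/-- The shortest-path distance of the graph `G` with edge weights `w`. -/
noncomputable def wdist {V : Type*} (G : SimpleGraph V) (w : Sym2 V → ℝ) (x y : V) : ℝ :=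
  ⨅ q : G.Walk x y, (q.edges.map w).sum

/-- A schedule for `k` servers: `c i s` is the position of server `s` after the first `i`
requests (only the indices up to the length of the request sequence matter). -/
abbrev Schedule (V : Type*) (k : ℕ) : Type _ := ℕ → Fin k → V

/-- The schedule `c` starts at `init`, and after each request some server is at the
requested vertex. -/
def Serves {V : Type*} {k : ℕ} (init : Fin k → V) (σ : List V) (c : Schedule V k) : Prop :=
  c 0 = init ∧ ∀ (i : ℕ) (hi : i < σ.length), ∃ s, c (i + 1) s = σ[i]

/-- The total distance moved by all servers during `n` requests. -/
noncomputable def cost {V : Type*} (G : SimpleGraph V) (w : Sym2 V → ℝ) {k : ℕ} (n : ℕ)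
    (c : Schedule V k) : ℝ :=
  ∑ i ∈ Finset.range n, ∑ s, wdist G w (c i s) (c (i + 1) s)

/-- `c` serves `σ`, at a cost that no other way of serving `σ` improves on. -/
def ServesOptimally {V : Type*} (G : SimpleGraph V) (w : Sym2 V → ℝ) {k : ℕ}
    (init : Fin k → V) (σ : List V) (c : Schedule V k) : Prop :=
  Serves init σ c ∧
    ∀ c' : Schedule V k, Serves init σ c' → cost G w σ.length c ≤ cost G w σ.length c'

/-- A deterministic online algorithm with an advice tape. Its arguments are the requests
received so far (the last one is to be served now) and the advice bits read so far, both
in order of arrival. Its value is `none` if it reads one more bit of the tape, and `some x`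
if it moves its servers to the positions `x` and waits for the next request. -/
abbrev OnlineAlgorithm (V : Type*) (k : ℕ) : Type _ := List V → List Bool → Option (Fin k → V)

/-- The first `q` bits on the infinite tape `B`. -/
def tapePrefix (B : ℕ → Bool) (q : ℕ) : List Bool := (List.range q).map B

/-- The computation of `A` on the request sequence `σ` with tape `B` yields the schedule `c`,
and `p i` bits have been read when the `i`-th request has been answered. At each request
the algorithm goes on reading until it answers. -/
def OnlineAlgorithm.Run {V : Type*} {k : ℕ} (A : OnlineAlgorithm V k) (init : Fin k → V)
    (B : ℕ → Bool) (σ : List V) (c : Schedule V k) (p : ℕ → ℕ) : Prop :=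
  c 0 = init ∧ p 0 = 0 ∧ ∀ i < σ.length,
    p i ≤ p (i + 1) ∧
    (∀ q, p i ≤ q → q < p (i + 1) → A (σ.take (i + 1)) (tapePrefix B q) = none) ∧
    A (σ.take (i + 1)) (tapePrefix B (p (i + 1))) = some (c (i + 1))

end KServer

/-! Balanced separators from a tree decomposition give every vertex `x` a hub set `H x` of O(α log
N) vertices such that every walk from `x` to `y` meets `H x ∩ H y` (`exists_hubs`). Hence some
common hub lies on a geodesic (`exists_hub_on_geodesic`), and naming a hub of a known vertex takes b
= O(log α + log log N) bits.

Fix an optimal solution that moves only the server answering the request, and tag each server with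
the hub on the way to its next request. At a request `r` the advice names the tag `v` of the server
that the optimum moves, which is also a hub of `r`. The algorithm moves any server tagged `v` to `r`
and reads its new tag. Servers with equal tags are interchangeable: a wrong choice shifts cost only
between the legs before the hub, and the sum of the distances from servers to their tags is a
potential that balances this (`Invariant.exists_step`).

Reading all k initial tags could exceed the budget, so they are read on demand, nearest to `v`
first. Choosing the optimum lexicographically minimal in cost and sum of server indices ensures that
a server it never uses cannot precede the one sought (`LexOptimal.lt_of_unused`, `eval_reveal`). So
at most n initial tags are read, and with two codes per request the total is at most 3bn bits. -/

namespace KServer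
open SimpleGraph

/-! ### Subtrees of a tree and their Helly property -/

section Trees

variable {ι : Type*} {T : SimpleGraph ι}

theorem _root_.SimpleGraph.IsTree.path_support_subset (hT : T.IsTree) {i j : ι} {p : T.Walk i j}
    (hp : p.IsPath) (q : T.Walk i j) : p.support ⊆ q.support := by
  classical
  have := hT.isAcyclic.subsingleton_path i j
  have h := Subsingleton.elim (⟨p, hp⟩ : T.Path i j) q.toPath
  have h2 : p = (q.toPath : T.Walk i j) := congrArg Subtype.val h
  rw [h2]
  exact q.support_bypass_subset_support

/-- A set of nodes of a tree that contains the paths between its elements. -/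
def PathClosed (T : SimpleGraph ι) (X : Set ι) : Prop :=
  ∀ (i l : ι) (q : T.Walk i l), q.IsPath → i ∈ X → l ∈ X → ∀ j ∈ q.support, j ∈ X

/-- The node of a path-closed set nearest to the root `ρ` separates the set from `ρ`. -/
theorem PathClosed.gate (hT : T.IsTree) {X : Set ι} (hX : PathClosed T X) {ρ t u : ι}
    (ht : t ∈ X) (hu : u ∈ X) (hmin : ∀ j ∈ X, T.dist ρ t ≤ T.dist ρ j) (q : T.Walk ρ u) :
    t ∈ q.support := by
  classical
  obtain ⟨p, hp⟩ := hT.connected.exists_walk_length_eq_dist ρ t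
  have hpp : p.IsPath := p.isPath_of_length_eq_dist hp
  obtain ⟨r, hr⟩ := (hT.connected t u).exists_isPath
  -- `r` stays in `X`, and `p` meets `X` only at its end `t` by minimality, so the two paths share
  -- only `t`.
  have hpath : (p.append r).IsPath := by
    rw [Walk.isPath_def, Walk.support_append, List.nodup_append]
    have hr' := hr.support_nodup
    rw [← Walk.cons_tail_support, List.nodup_cons] at hr'
    refine ⟨hpp.support_nodup, hr'.2, ?_⟩
    rintro a ha b hb rfl
    have haX : a ∈ X := hX t u r hr ht hu a (List.mem_of_mem_tail hb)
    have h1 := hmin a haX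
    have h2 : T.dist ρ a ≤ (p.takeUntil a ha).length := dist_le _
    have h3 : (p.takeUntil a ha).length + (p.dropUntil a ha).length = p.length := by
      rw [← Walk.length_append, Walk.take_spec]
    have h4 : (p.dropUntil a ha).length = 0 := by omega
    have h5 : a = t := Walk.eq_of_length_eq_zero h4
    exact hr'.1 (h5 ▸ hb)
  exact hT.path_support_subset hpath q (by simp)

/-- Helly property of subtrees, for a family indexed by the nodes. -/
theorem exists_mem_of_pathClosed [Finite ι] (hT : T.IsTree) (X : ι → Set ι)
    (hX : ∀ i, PathClosed T (X i)) (hne : ∀ i j, (X i ∩ X j).Nonempty) : ∃ i, i ∈ X i := by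
  classical
  obtain ⟨ρ⟩ := hT.connected.nonempty
  have htop : ∀ i, ∃ t ∈ X i, ∀ j ∈ X i, T.dist ρ t ≤ T.dist ρ j := fun i =>
    Set.exists_min_image (X i) (T.dist ρ) (Set.toFinite _) ((hne i i).mono Set.inter_subset_left)
  choose t ht hmin using htop
  have : Nonempty ι := ⟨ρ⟩
  -- Take the set whose top is deepest. A path from `ρ` to a common node of `X a` and `X (t a)`
  -- passes both tops. Either `t a` comes after `t (t a)` and lies in `X (t a)` by path-closedness,
  -- or maximal depth makes the tops coincide.
  obtain ⟨a, ha⟩ := Finite.exists_max fun i => T.dist ρ (t i)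
  refine ⟨t a, ?_⟩
  obtain ⟨u, hua, hub⟩ := hne a (t a)
  obtain ⟨q, hq⟩ := hT.connected.exists_walk_length_eq_dist ρ u
  have hqp : q.IsPath := q.isPath_of_length_eq_dist hq
  have h1 := (hX a).gate hT (ht a) hua (hmin a) q
  have h2 := (hX (t a)).gate hT (ht (t a)) hub (hmin (t a)) q
  rw [← q.take_spec h2, Walk.mem_support_append_iff] at h1
  rcases h1 with h1 | h1
  · have h3 : T.dist ρ (t a) ≤ ((q.takeUntil _ h2).takeUntil _ h1).length := dist_le _
    have h4 : ((q.takeUntil _ h2).takeUntil _ h1).length + ((q.takeUntil _ h2).dropUntil _ h1).length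
        = (q.takeUntil _ h2).length := by
      rw [← Walk.length_append, Walk.take_spec]
    have h5 : (q.takeUntil _ h2).length + (q.dropUntil _ h2).length = q.length := by
      rw [← Walk.length_append, Walk.take_spec]
    have h6 : T.dist (t (t a)) u ≤ (q.dropUntil _ h2).length := dist_le _
    have h7 : T.dist ρ u ≤ T.dist ρ (t (t a)) + T.dist (t (t a)) u := hT.connected.dist_triangle
    have h8 := ha (t a)
    have h9 : ((q.takeUntil _ h2).dropUntil _ h1).length = 0 := by omega
    have h10 := Walk.eq_of_length_eq_zero h9
    have := ht (t a)
    rwa [← h10] at this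
  · exact hX (t a) _ _ _ (hqp.dropUntil h2) (ht _) hub _ h1

end Trees

/-! ### Balanced separators and hub sets -/

section Separators

variable {V : Type*} {G : SimpleGraph V}

/-- The nodes whose bags meet a connected set of vertices form a subtree. -/
theorem TreeDecomposition.pathClosed (D : TreeDecomposition G) (A : Set V)
    (hA : ∀ x ∈ A, ∀ y ∈ A, ∃ q : G.Walk x y, ∀ z ∈ q.support, z ∈ A) :
    PathClosed D.tree {i | ∃ x ∈ D.bag i, x ∈ A} := by
  have key : ∀ (x y : V) (w : G.Walk x y), (∀ z ∈ w.support, z ∈ A) →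
      ∀ (i l : Fin D.size) (q : D.tree.Walk i l), q.IsPath → x ∈ D.bag i → y ∈ D.bag l →
      ∀ j ∈ q.support, ∃ z ∈ D.bag j, z ∈ A := by
    intro x y w
    induction w with
    | nil =>
      intro hw i l q hq hi hl j hj
      exact ⟨_, D.path_mem i j l q hq hj _ hi hl, hw _ (by simp)⟩
    | @cons x z y hadj w ih =>
      intro hw i l q hq hi hl j hj
      obtain ⟨m, hmx, hmz⟩ := D.edge_mem x z hadj
      obtain ⟨q₁, hq₁⟩ := (D.isTree.connected i m).exists_isPath
      obtain ⟨q₂, hq₂⟩ := (D.isTree.connected m l).exists_isPath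
      have := D.isTree.path_support_subset hq (q₁.append q₂) hj
      rw [Walk.mem_support_append_iff] at this
      rcases this with h | h
      · exact ⟨x, D.path_mem i j m q₁ hq₁ h x hi hmx, hw _ (by simp)⟩
      · exact ih (fun a ha => hw a (by simp [ha])) m l q₂ hq₂ hmz hl j h
  rintro i l q hq ⟨x, hxi, hx⟩ ⟨y, hyl, hy⟩ j hj
  obtain ⟨w, hw⟩ := hA x hx y hy
  exact key x y w hw i l q hq hxi hyl j hj

/-- The vertices that a walk inside `W` connects with `x`. -/
noncomputable def component (G : SimpleGraph V) (W : Finset V) (x : V) : Finset V := by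
  classical exact W.filter fun y => ∃ q : G.Walk x y, ∀ z ∈ q.support, z ∈ W

theorem mem_component {W : Finset V} {x y : V} :
    y ∈ component G W x ↔ ∃ q : G.Walk x y, ∀ z ∈ q.support, z ∈ W := by
  classical
  simp only [component, Finset.mem_filter, and_iff_right_iff_imp]
  rintro ⟨q, hq⟩
  exact hq y (by simp)

theorem component_subset {W : Finset V} {x : V} : component G W x ⊆ W := by
  classical
  exact Finset.filter_subset _ _

theorem support_subset_component {W : Finset V} {x y : V} (q : G.Walk x y)
    (hq : ∀ z ∈ q.support, z ∈ W) : ∀ z ∈ q.support, z ∈ component G W x := by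
  classical
  intro z hz
  exact mem_component.2 ⟨q.takeUntil z hz, fun a ha => hq a (q.support_takeUntil_subset_support hz ha)⟩

theorem component_eq {W : Finset V} {x y : V} (q : G.Walk x y)
    (hq : ∀ z ∈ q.support, z ∈ W) : component G W y = component G W x := by
  ext z
  simp only [mem_component]
  constructor
  · rintro ⟨r, hr⟩
    refine ⟨q.append r, fun a ha => ?_⟩
    rw [Walk.mem_support_append_iff] at ha
    exact ha.elim (hq a) (hr a)
  · rintro ⟨r, hr⟩
    refine ⟨q.reverse.append r, fun a ha => ?_⟩
    rw [Walk.mem_support_append_iff, Walk.support_reverse, List.mem_reverse] at ha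
    exact ha.elim (hq a) (hr a)

/-- Some bag is a balanced separator of `W`. -/
theorem TreeDecomposition.exists_separator [DecidableEq V] (D : TreeDecomposition G)
    (W : Finset V) : ∃ i, ∀ x, 2 * (component G (W \ D.bag i) x).card ≤ W.card := by
  by_contra! h
  choose x hx using h
  have hsub : ∀ i, component G (W \ D.bag i) (x i) ⊆ W := fun i =>
    component_subset.trans Finset.sdiff_subset
  -- If every bag left a component with more than half of `W`, these components would pairwise
  -- intersect, and so would their subtrees. The Helly property then yields a bag meeting a
  -- component of its own complement.
  obtain ⟨i, y, hy, hyA⟩ := exists_mem_of_pathClosed D.isTree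
    (fun i => {j | ∃ y ∈ D.bag j, y ∈ (component G (W \ D.bag i) (x i) : Set V)})
    (fun i => D.pathClosed _ (by
      intro a ha b hb
      obtain ⟨p, hp⟩ := mem_component.1 (Finset.mem_coe.1 ha)
      obtain ⟨q, hq⟩ := mem_component.1 (Finset.mem_coe.1 hb)
      refine ⟨p.reverse.append q, fun z hz => ?_⟩
      rw [Walk.mem_support_append_iff, Walk.support_reverse, List.mem_reverse] at hz
      exact hz.elim (support_subset_component p hp z) (support_subset_component q hq z)))
    (by
      intro i j
      obtain ⟨y, hy⟩ : (component G (W \ D.bag i) (x i) ∩ component G (W \ D.bag j) (x j)).Nonempty := by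
        by_contra hne
        rw [Finset.not_nonempty_iff_eq_empty, ← Finset.disjoint_iff_inter_eq_empty] at hne
        have h1 := Finset.card_le_card (Finset.union_subset (hsub i) (hsub j))
        rw [Finset.card_union_of_disjoint hne] at h1
        have := hx i
        have := hx j
        omega
      obtain ⟨l, hl⟩ := D.vertex_mem y
      rw [Finset.mem_inter] at hy
      exact ⟨l, ⟨y, hl, hy.1⟩, ⟨y, hl, hy.2⟩⟩)
  exact (Finset.mem_sdiff.1 (component_subset (Finset.mem_coe.1 hyA))).2 hy

/-- Hub sets for the walks inside `W`. -/
theorem TreeDecomposition.exists_hubs_of_card_lt (D : TreeDecomposition G) {a : ℕ}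
    (hD : ∀ i, (D.bag i).card ≤ a) (m : ℕ) :
    ∀ W : Finset V, W.card < 2 ^ m → ∃ H : V → Finset V, (∀ x, (H x).card ≤ m * a) ∧
      ∀ (x y : V) (q : G.Walk x y), (∀ z ∈ q.support, z ∈ W) → ∃ v ∈ q.support, v ∈ H x ∧ v ∈ H y := by
  classical
  induction m with
  | zero =>
    intro W hW
    have hW : W = ∅ := by simpa using hW
    exact ⟨fun _ => ∅, by simp, fun x y q hq => by simpa [hW] using hq x (by simp)⟩
  | succ m ih =>
    intro W hW
    obtain ⟨i, hi⟩ := D.exists_separator W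
    have hlt : ∀ x, (component G (W \ D.bag i) x).card < 2 ^ m := fun x => by
      have := hi x
      rw [pow_succ] at hW
      omega
    choose H hH hhub using ih
    -- A walk either meets the separator or stays in one component, where the recursion applies;
    -- each of the `m` levels adds one bag.
    refine ⟨fun x => D.bag i ∪ H _ (hlt x) x, fun x => ?_, fun x y q hq => ?_⟩
    · refine (Finset.card_union_le _ _).trans ?_
      have := hH _ (hlt x) x
      have := hD i
      rw [add_mul]
      omega
    · by_cases hS : ∃ v ∈ q.support, v ∈ D.bag i
      · obtain ⟨v, hv, hvS⟩ := hS
        exact ⟨v, hv, Finset.mem_union_left _ hvS, Finset.mem_union_left _ hvS⟩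
      · push Not at hS
        have hq' : ∀ z ∈ q.support, z ∈ W \ D.bag i := fun z hz =>
          Finset.mem_sdiff.2 ⟨hq z hz, hS z hz⟩
        obtain ⟨v, hv, hvx, hvy⟩ := hhub _ (hlt x) x y q (support_subset_component q hq')
        refine ⟨v, hv, Finset.mem_union_right _ hvx, Finset.mem_union_right _ ?_⟩
        have heq := component_eq q hq'
        have : H _ (hlt y) y = H _ (hlt x) y := by simp only [heq]
        rw [this]
        exact hvy

end Separators

/-! ### Shortest-path distance and hubs on geodesics -/

section Distance

variable {V : Type*} {G : SimpleGraph V} {w : Sym2 V → ℝ}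

theorem walk_sum_nonneg (hw : ∀ e ∈ G.edgeSet, 0 < w e) {x y : V} (q : G.Walk x y) :
    0 ≤ (q.edges.map w).sum := by
  refine List.sum_nonneg fun a ha => ?_
  obtain ⟨e, he, rfl⟩ := List.mem_map.1 ha
  exact (hw e (q.edges_subset_edgeSet he)).le

theorem wdist_nonneg (hw : ∀ e ∈ G.edgeSet, 0 < w e) (x y : V) : 0 ≤ wdist G w x y :=
  Real.iInf_nonneg fun q => walk_sum_nonneg hw q

theorem wdist_le (hw : ∀ e ∈ G.edgeSet, 0 < w e) {x y : V} (q : G.Walk x y) :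
    wdist G w x y ≤ (q.edges.map w).sum :=
  ciInf_le ⟨0, by rintro _ ⟨q, rfl⟩; exact walk_sum_nonneg hw q⟩ q

theorem wdist_self (hw : ∀ e ∈ G.edgeSet, 0 < w e) (x : V) : wdist G w x x = 0 :=
  le_antisymm (by simpa using wdist_le hw (Walk.nil : G.Walk x x)) (wdist_nonneg hw x x)

theorem wdist_triangle (hG : G.Connected) (hw : ∀ e ∈ G.edgeSet, 0 < w e) (x y z : V) :
    wdist G w x z ≤ wdist G w x y + wdist G w y z := by
  have : Nonempty (G.Walk x y) := hG.preconnected x y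
  have : Nonempty (G.Walk y z) := hG.preconnected y z
  have h : wdist G w x z - wdist G w y z ≤ wdist G w x y := by
    refine le_ciInf fun q => ?_
    have h : wdist G w x z - (q.edges.map w).sum ≤ wdist G w y z := by
      refine le_ciInf fun r => ?_
      have := wdist_le hw (q.append r)
      rw [Walk.edges_append, List.map_append, List.sum_append] at this
      linarith
    linarith
  linarith

/-- The distance is an infimum over walks. Since `H x ∩ H y` is finite, the hub with the smallest
detour works against all walks at once, and no shortest walk has to be produced. -/
theorem exists_hub_on_geodesic (hG : G.Connected) (hw : ∀ e ∈ G.edgeSet, 0 < w e)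
    {H : V → Finset V}
    (hH : ∀ (x y : V) (q : G.Walk x y), ∃ v ∈ q.support, v ∈ H x ∧ v ∈ H y) (x y : V) :
    ∃ v, v ∈ H x ∧ v ∈ H y ∧ wdist G w x v + wdist G w v y = wdist G w x y := by
  classical
  have hne : Nonempty (G.Walk x y) := hG.preconnected x y
  obtain ⟨v, hv, hmin⟩ := Finset.exists_min_image (H x ∩ H y)
    (fun v => wdist G w x v + wdist G w v y) (by
      obtain ⟨v, -, hv⟩ := hH x y hne.some
      exact ⟨v, Finset.mem_inter.2 hv⟩)
  rw [Finset.mem_inter] at hv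
  refine ⟨v, hv.1, hv.2, le_antisymm (le_ciInf fun q => ?_) (wdist_triangle hG hw x v y)⟩
  obtain ⟨u, hu, hux⟩ := hH x y q
  refine (hmin u (Finset.mem_inter.2 hux)).trans ?_
  have h1 := wdist_le hw (q.takeUntil u hu)
  have h2 := wdist_le hw (q.dropUntil u hu)
  have h3 : (q.edges.map w).sum = ((q.takeUntil u hu).edges.map w).sum
      + ((q.dropUntil u hu).edges.map w).sum := by
    rw [← List.sum_append, ← List.map_append, ← Walk.edges_append, Walk.take_spec]
  linarith

end Distance

/-! ### Hub sets bounded by the treewidth -/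

section Treewidth

variable {V : Type*} [Fintype V] {G : SimpleGraph V}

theorem exists_treeDecomposition (G : SimpleGraph V) [Nonempty V] :
    ∃ D : TreeDecomposition G, D.HasWidth (treewidth G) := by
  refine Nat.sInf_mem (s := {a : ℕ | ∃ D : TreeDecomposition G, D.HasWidth a}) ?_
  -- A single bag holding all vertices shows that the infimum is over a nonempty set.
  refine ⟨Fintype.card V - 1, ⟨1, ⊥, IsTree.of_subsingleton, fun _ => Finset.univ, by simp, by simp, by simp⟩, ?_⟩
  have := Fintype.card_pos (α := V)
  simp only [TreeDecomposition.HasWidth, Finset.univ_unique, Finset.sup_singleton, Finset.card_univ]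
  omega

theorem one_le_treewidth (hG : G.Connected) (h : 2 ≤ Fintype.card V) : 1 ≤ treewidth G := by
  classical
  have : Nontrivial V := Fintype.one_lt_card_iff_nontrivial.1 h
  obtain ⟨D, hD⟩ := exists_treeDecomposition G
  obtain ⟨x⟩ := hG.nonempty
  obtain ⟨y, hxy⟩ := hG.preconnected.exists_adj_of_nontrivial x
  obtain ⟨i, hx, hy⟩ := D.edge_mem x y hxy
  have h1 : ({x, y} : Finset V).card ≤ (D.bag i).card :=
    Finset.card_le_card (by simp [Finset.insert_subset_iff, hx, hy])
  rw [Finset.card_pair hxy.ne] at h1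
  have h2 := Finset.le_sup (f := fun i => (D.bag i).card) (Finset.mem_univ i)
  rw [TreeDecomposition.HasWidth] at hD
  omega

theorem exists_hubs (G : SimpleGraph V) [Nonempty V] :
    ∃ H : V → Finset V,
      (∀ x, (H x).card ≤ (Nat.log 2 (Fintype.card V) + 1) * (treewidth G + 1)) ∧
      ∀ (x y : V) (q : G.Walk x y), ∃ v ∈ q.support, v ∈ H x ∧ v ∈ H y := by
  obtain ⟨D, hD⟩ := exists_treeDecomposition G
  have hbag : ∀ i, (D.bag i).card ≤ treewidth G + 1 := fun i =>
    hD ▸ Finset.le_sup (f := fun i => (D.bag i).card) (Finset.mem_univ i)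
  obtain ⟨H, h1, h2⟩ := D.exists_hubs_of_card_lt hbag (Nat.log 2 (Fintype.card V) + 1) Finset.univ
    (Nat.lt_pow_succ_log_self one_lt_two _)
  exact ⟨H, h1, fun x y q => h2 x y q (by simp)⟩

end Treewidth

end KServer

/-! ### Bit-reading computations and online algorithms -/

namespace KServer

/-- A computation that reads bits one after the other and ends with a value. -/
inductive Reader (α : Type*)
  | done (a : α) : Reader α
  | ask (f : Bool → Reader α) : Reader α

namespace Reader

variable {α β : Type*}

/-- The value of a computation and the bits it leaves unread, if the bits suffice. -/
def eval : Reader α → List Bool → Option (α × List Bool)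
  | done a, l => some (a, l)
  | ask _, [] => none
  | ask f, b :: l => eval (f b) l

def bind (r : Reader α) (g : α → Reader β) : Reader β :=
  match r with
  | done a => g a
  | ask f => ask fun b => (f b).bind g

/-- Reads `n` bits and continues with the list of these bits. -/
def block : ℕ → (List Bool → Reader α) → Reader α
  | 0, g => g []
  | n + 1, g => ask fun b => block n fun l => g (b :: l)

theorem eval_append {r : Reader α} {l : List Bool} {a : α} (h : r.eval l = some (a, []))
    (l' : List Bool) : r.eval (l ++ l') = some (a, l') := by
  induction r generalizing l with
  | done b => simp_all [eval]
  | ask f ih =>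
    cases l with
    | nil => simp [eval] at h
    | cons b l => exact ih b h

/-- Computations are self-delimiting. This supplies the clause of `Run` that the algorithm keeps
reading until its segment of the tape is used up. -/
theorem eval_take {r : Reader α} {l : List Bool} {a : α} (h : r.eval l = some (a, []))
    {m : ℕ} (hm : m < l.length) : r.eval (l.take m) = none := by
  induction r generalizing l m with
  | done b => simp_all [eval]
  | ask f ih =>
    cases l with
    | nil => simp [eval] at h
    | cons b l =>
      cases m with
      | zero => rfl
      | succ m => exact ih b h (by simpa using hm)

theorem eval_bind (r : Reader α) (g : α → Reader β) {l l' : List Bool} {a : α}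
    (h : r.eval l = some (a, l')) : (r.bind g).eval l = (g a).eval l' := by
  induction r generalizing l with
  | done b =>
    simp only [eval, Option.some.injEq, Prod.mk.injEq] at h
    obtain ⟨rfl, rfl⟩ := h
    rfl
  | ask f ih =>
    cases l with
    | nil => simp [eval] at h
    | cons b l => exact ih b h

theorem eval_block (g : List Bool → Reader α) (l l' : List Bool) :
    (block l.length g).eval (l ++ l') = (g l).eval l' := by
  induction l generalizing g with
  | nil => rfl
  | cons b l ih => exact ih _

end Reader

section Algorithm

variable {S V : Type*} {k : ℕ}

/-- The computation that serves a request sequence by iterating `step`. -/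
def program (step : V → S → Reader S) (s₀ : S) (σ : List V) : Reader S :=
  σ.foldl (fun r v => r.bind (step v)) (.done s₀)

/-- The online algorithm with the given step, which answers with the positions that `pos` reads
off the state. -/
def onlineAlgorithm (step : V → S → Reader S) (s₀ : S) (pos : S → Fin k → V) :
    OnlineAlgorithm V k := fun σ l =>
  match (program step s₀ σ).eval l with
  | some (s, []) => some (pos s)
  | _ => none

theorem program_take_succ (step : V → S → Reader S) (s₀ : S) (σ : List V) {i : ℕ}
    (hi : i < σ.length) :
    program step s₀ (σ.take (i + 1)) = (program step s₀ (σ.take i)).bind (step σ[i]) := by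
  rw [program, ← List.take_concat_get' σ i hi, List.foldl_append]
  rfl

/-- Runs of the single steps combine to a run of the algorithm. -/
theorem exists_run (step : V → S → Reader S) (s₀ : S) (pos : S → Fin k → V) (σ : List V)
    (st : ℕ → S) (seg : ℕ → List Bool) (h0 : st 0 = s₀)
    (hstep : ∀ (i : ℕ) (hi : i < σ.length), (step σ[i] (st i)).eval (seg i) = some (st (i + 1), [])) :
    ∃ (B : ℕ → Bool) (p : ℕ → ℕ),
      (onlineAlgorithm step s₀ pos).Run (pos s₀) B σ (fun i => pos (st i)) p ∧
      p σ.length = ∑ i ∈ Finset.range σ.length, (seg i).length := by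
  let L : ℕ → List Bool := fun i => (List.range i).flatMap seg
  have hLs : ∀ i, L (i + 1) = L i ++ seg i := fun i => by simp [L, List.range_succ]
  have hpre : ∀ i j, i ≤ j → L i <+: L j := by
    intro i j hij
    induction hij with
    | refl => exact List.prefix_rfl
    | step _ ih => exact ih.trans (hLs _ ▸ List.prefix_append _ _)
  -- The padding `false` lies beyond all segments and is never read.
  let B : ℕ → Bool := fun m => (L σ.length).getD m false
  have hB : ∀ q ≤ (L σ.length).length, tapePrefix B q = (L σ.length).take q := by
    intro q hq
    apply List.ext_getElem
    · simp [tapePrefix, hq]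
    · intro m h1 h2
      simp only [List.length_take] at h2
      simp [tapePrefix, B, List.getElem?_eq_getElem (show m < (L σ.length).length by omega)]
  have hprog : ∀ i ≤ σ.length, (program step s₀ (σ.take i)).eval (L i) = some (st i, []) := by
    intro i
    induction i with
    | zero => intro _; simp [program, Reader.eval, L, h0]
    | succ i ih =>
      intro hi
      rw [program_take_succ _ _ _ hi, hLs,
        Reader.eval_bind _ _ (Reader.eval_append (ih (by omega)) (seg i))]
      exact hstep i hi
  have hlen : ∀ i, (L i).length = ∑ j ∈ Finset.range i, (seg j).length := by
    intro i
    induction i with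
    | zero => simp [L]
    | succ i ih => rw [hLs, List.length_append, ih, Finset.sum_range_succ]
  have htake : ∀ i ≤ σ.length, ∀ q ≤ (L i).length, tapePrefix B q = (L i).take q := by
    intro i hi q hq
    have h := hpre i _ hi
    rw [hB q (hq.trans h.length_le)]
    obtain ⟨t, ht⟩ := h
    rw [← ht, List.take_append_of_le_length hq]
  refine ⟨B, fun i => (L i).length, ⟨?_, ?_, ?_⟩, hlen _⟩
  · simp [h0]
  · simp [L]
  · intro i hi
    refine ⟨(hpre i (i + 1) (by omega)).length_le, fun q hq hq' => ?_, ?_⟩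
    · change (L i).length ≤ q at hq
      change q < (L (i + 1)).length at hq'
      rw [htake (i + 1) hi q hq'.le, hLs, List.take_append, List.take_of_length_le hq]
      have h1 : ((step σ[i] (st i)).eval ((seg i).take (q - (L i).length))) = none :=
        Reader.eval_take (hstep i hi) (by rw [hLs, List.length_append] at hq'; omega)
      rw [onlineAlgorithm, program_take_succ _ _ _ hi,
        Reader.eval_bind _ _ (Reader.eval_append (hprog i hi.le) _), h1]
    · rw [htake (i + 1) hi _ le_rfl, List.take_length, onlineAlgorithm, hprog (i + 1) hi]

end Algorithm

end KServer

namespace KServer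
open Function

/-! ### Lazy schedules and lexicographically optimal assignments -/

section LazySchedules

variable {V : Type*} {k : ℕ} (d : V → V → ℝ)

/-- The cost of serving requests from the configuration `P` when each request comes with the
server that moves to it. -/
def lazyCost : (Fin k → V) → List (V × Fin k) → ℝ
  | _, [] => 0
  | P, a :: l => d (P a.2) a.1 + lazyCost (update P a.2 a.1) l

variable {d}

/-- Every schedule can be made lazy. -/
theorem exists_lazyCost_le (h0 : ∀ x y, 0 ≤ d x y) (hself : ∀ x, d x x = 0)
    (htri : ∀ x y z, d x z ≤ d x y + d y z) (σ : List V) :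
    ∀ c : Schedule V k, (∀ (i : ℕ) (hi : i < σ.length), ∃ s, c (i + 1) s = σ[i]) →
      ∀ P : Fin k → V, ∃ l : List (V × Fin k), l.map Prod.fst = σ ∧
        lazyCost d P l ≤ ∑ s, d (P s) (c 0 s) +
          ∑ i ∈ Finset.range σ.length, ∑ s, d (c i s) (c (i + 1) s) := by
  induction σ with
  | nil =>
    intro c _ P
    refine ⟨[], rfl, ?_⟩
    simpa [lazyCost] using Finset.sum_nonneg fun s _ => h0 (P s) (c 0 s)
  | cons r σ ih =>
    intro c hc P
    obtain ⟨s, hs⟩ := hc 0 (by simp)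
    obtain ⟨l, hl, hle⟩ := ih (fun i => c (i + 1))
      (fun i hi => hc (i + 1) (by simpa using hi)) (update P s r)
    refine ⟨(r, s) :: l, by simp [hl], ?_⟩
    simp only [List.getElem_cons_zero, zero_add] at hs
    rw [List.length_cons, Finset.sum_range_succ', lazyCost]
    -- The sum of the distances from the lazy servers to those of `c` is the movement still owed;
    -- postponing moves costs nothing extra by the triangle inequality.
    have key : d (P s) r + ∑ t, d (update P s r t) (c 1 t) ≤
        ∑ t, d (P t) (c 0 t) + ∑ t, d (c 0 t) (c 1 t) := by
      rw [← Finset.sum_add_distrib, ← Finset.add_sum_erase _ _ (Finset.mem_univ s),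
        ← Finset.add_sum_erase Finset.univ (fun t => d (P t) (c 0 t) + _) (Finset.mem_univ s)]
      have h1 : d (update P s r s) (c 1 s) = 0 := by simp [hs, hself]
      have h2 := htri (P s) (c 0 s) (c 1 s)
      rw [hs] at h2
      have h3 : ∑ t ∈ Finset.univ.erase s, d (update P s r t) (c 1 t) ≤
          ∑ t ∈ Finset.univ.erase s, (d (P t) (c 0 t) + d (c 0 t) (c 1 t)) := by
        refine Finset.sum_le_sum fun t ht => ?_
        rw [update_of_ne (Finset.ne_of_mem_erase ht)]
        exact htri _ _ _
      rw [h1]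
      simp only [hs]
      linarith
    simp only [zero_add] at hle ⊢
    linarith

/-- The requests `l` have been assigned to servers at minimal cost, and among the assignments of
minimal cost, one with minimal sum of indices has been chosen. -/
def LexOptimal (d : V → V → ℝ) (P : Fin k → V) (l : List (V × Fin k)) : Prop :=
  ∀ l' : List (V × Fin k), l'.map Prod.fst = l.map Prod.fst →
    toLex (lazyCost d P l, (l.map fun a => (a.2 : ℕ)).sum) ≤
      toLex (lazyCost d P l', (l'.map fun a => (a.2 : ℕ)).sum)

theorem exists_lexOptimal [Finite V] (hk : 0 < k) (d : V → V → ℝ) (P : Fin k → V) (σ : List V) :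
    ∃ l, l.map Prod.fst = σ ∧ LexOptimal d P l := by
  obtain ⟨l, hl, hmin⟩ := Set.exists_min_image {l : List (V × Fin k) | l.map Prod.fst = σ}
    (fun l => toLex (lazyCost d P l, (l.map fun a => (a.2 : ℕ)).sum))
    ((List.finite_length_eq (V × Fin k) σ.length).subset (by
      rintro l rfl
      simp))
    ⟨σ.map fun v => (v, ⟨0, hk⟩), by simp [Function.comp_def]⟩
  exact ⟨l, hl, fun l' hl' => hmin l' (hl'.trans hl)⟩

/-- Assigns the requests of the server `s` to the server `t`. -/
def reassign (s t : Fin k) (l : List (V × Fin k)) : List (V × Fin k) :=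
  l.map fun a => (a.1, if a.2 = s then t else a.2)

/-- An otherwise idle `t` standing where `s` would stand can replay the moves of `s`. -/
theorem lazyCost_reassign_of_eq {s t : Fin k} (l : List (V × Fin k))
    (ht : ∀ a ∈ l, a.2 ≠ t) : ∀ P P' : Fin k → V, P' t = P s → (∀ u, u ≠ s → u ≠ t → P' u = P u) →
      lazyCost d P' (reassign s t l) = lazyCost d P l := by
  induction l with
  | nil => intros; rfl
  | cons a l ih =>
    intro P P' h1 h2
    have hat := ht a (by simp)
    have ih := ih fun a ha => ht a (by simp [ha])
    simp only [reassign, List.map_cons, lazyCost]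
    by_cases ha : a.2 = s
    · simp only [ha, if_true, h1]
      congr 1
      refine ih _ _ (by simp) fun u hus hut => ?_
      rw [update_of_ne hut, update_of_ne hus, h2 u hus hut]
    · simp only [ha, if_false, h2 _ ha hat]
      congr 1
      refine ih _ _ ?_ fun u hus hut => ?_
      · rw [update_of_ne hat.symm, update_of_ne (Ne.symm ha), h1]
      · by_cases hu : u = a.2
        · simp [hu]
        · rw [update_of_ne hu, update_of_ne hu, h2 u hus hut]

/-- The first request that `l` assigns to `s`. -/
def nextRequest (s : Fin k) (l : List (V × Fin k)) : Option V :=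
  (l.find? fun a => a.2 = s).map Prod.fst

theorem nextRequest_cons_self (r : V) (s : Fin k) (l : List (V × Fin k)) :
    nextRequest s ((r, s) :: l) = some r := by simp [nextRequest]

theorem nextRequest_cons_of_ne (r : V) {s t : Fin k} (h : t ≠ s) (l : List (V × Fin k)) :
    nextRequest t ((r, s) :: l) = nextRequest t l := by simp [nextRequest, h.symm]

theorem nextRequest_eq_none {s : Fin k} {l : List (V × Fin k)} :
    nextRequest s l = none ↔ ∀ a ∈ l, a.2 ≠ s := by simp [nextRequest]

/-- Only the first move of `s` changes its price, because `t` makes it from its own position;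
afterwards `lazyCost_reassign_of_eq` applies. -/
theorem lazyCost_reassign {s t : Fin k} (hst : s ≠ t) (l : List (V × Fin k))
    (ht : ∀ a ∈ l, a.2 ≠ t) {r : V} (hr : nextRequest s l = some r) : ∀ P : Fin k → V,
      lazyCost d P (reassign s t l) + d (P s) r = lazyCost d P l + d (P t) r := by
  induction l with
  | nil => simp [nextRequest] at hr
  | cons a l ih =>
    obtain ⟨r', u⟩ := a
    intro P
    have hut : u ≠ t := ht (r', u) (by simp)
    have ht' : ∀ a ∈ l, a.2 ≠ t := fun a ha => ht a (by simp [ha])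
    by_cases hu : u = s
    · subst hu
      rw [nextRequest_cons_self, Option.some_inj] at hr
      subst hr
      simp only [reassign, List.map_cons, lazyCost, if_true]
      have := lazyCost_reassign_of_eq (d := d) (s := u) l ht' (update P u r') (update P t r') (by simp)
        (fun v hv hv' => by rw [update_of_ne hv, update_of_ne hv'])
      rw [reassign] at this
      rw [this]
      ring
    · rw [nextRequest_cons_of_ne _ (Ne.symm hu)] at hr
      have := ih ht' hr (update P u r')
      rw [update_of_ne (Ne.symm hu), update_of_ne hut.symm] at this
      simp only [reassign, List.map_cons, lazyCost, hu, if_false] at this ⊢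
      linarith

theorem sum_reassign_lt {s t : Fin k} (hts : t < s) (l : List (V × Fin k)) (hl : ∃ a ∈ l, a.2 = s) :
    ((reassign s t l).map fun a => (a.2 : ℕ)).sum < (l.map fun a => (a.2 : ℕ)).sum := by
  rw [reassign, List.map_map]
  obtain ⟨a, ha, has⟩ := hl
  refine List.sum_lt_sum _ _ (fun b _ => ?_) ⟨a, ha, ?_⟩
  · simp only [comp_apply]
    split_ifs with h
    · rw [h]; exact hts.le
    · exact le_rfl
  · simpa [has] using hts

/-- In an optimal assignment, a used server beats all unused ones. -/
theorem LexOptimal.lt_of_unused {P : Fin k → V} {l : List (V × Fin k)} (hl : LexOptimal d P l)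
    (htri : ∀ x y z, d x z ≤ d x y + d y z) {s t : Fin k} {r v : V}
    (hs : nextRequest s l = some r) (ht : nextRequest t l = none)
    (hv : d (P s) v + d v r = d (P s) r) :
    toLex (d (P s) v, s) < toLex (d (P t) v, t) := by
  have hst : s ≠ t := by
    rintro rfl
    simp [hs] at ht
  have h1 := lazyCost_reassign (d := d) hst l (nextRequest_eq_none.1 ht) hs P
  have h2 := hl (reassign s t l) (by simp [reassign, Function.comp_def])
  have h3 := htri (P t) v r
  rw [Prod.Lex.toLex_le_toLex] at h2
  rw [Prod.Lex.toLex_lt_toLex]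
  -- Otherwise handing all requests of `s` to `t` would lower the cost or, in case of a tie with `t
  -- < s`, keep it from rising while lowering the sum of indices.
  by_contra! hcon
  simp only at h2 hcon
  rcases h2 with h2 | ⟨h2, h2'⟩
  · exact absurd hcon.1 (not_le.2 (by linarith))
  · have h4 : d (P s) v = d (P t) v := le_antisymm (by linarith) hcon.1
    have hts : t < s := lt_of_le_of_ne (hcon.2 h4) hst.symm
    have : ∃ a ∈ l, a.2 = s := by
      by_contra! hn
      rw [nextRequest_eq_none.2 hn] at hs
      simp at hs
    exact absurd (sum_reassign_lt hts l this) (not_lt.2 h2')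

end LazySchedules

/-! ### Fixed-length codes -/

section Codes

/-- Fixed-length codes for the elements of a small set and a dummy. -/
theorem exists_code {V : Type*} (S : Finset V) {b : ℕ} (hb : S.card + 1 ≤ 2 ^ b) :
    ∃ (enc : Option V → List Bool) (dec : List Bool → Option V), (∀ o, (enc o).length = b) ∧
      ∀ o, (∀ v, o = some v → v ∈ S) → dec (enc o) = o := by
  classical
  obtain ⟨f⟩ : Nonempty (Finset.insertNone S ↪ List.Vector Bool b) := by
    apply Function.Embedding.nonempty_of_card_le
    simpa using hb
  have hmem : ∀ o : Option V, (∀ v, o = some v → v ∈ S) → o ∈ Finset.insertNone S := by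
    intro o ho
    rw [Finset.mem_insertNone]
    exact fun a ha => ho a ha
  refine ⟨fun o => if h : o ∈ Finset.insertNone S then (f ⟨o, h⟩).1 else List.replicate b false,
    fun l => if h : ∃ o, (f o).1 = l then h.choose.1 else none, fun o => ?_, fun o ho => ?_⟩
  · dsimp only
    split_ifs
    · exact (f _).2
    · simp
  · have h := hmem o ho
    have h' : ∃ o', (f o').1 = (f ⟨o, h⟩).1 := ⟨_, rfl⟩
    simp only [h, dif_pos, h', f.injective (Subtype.ext h'.choose_spec)]

end Codes

end KServer

/-! ### The algorithm with tags revealed on demand -/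

namespace KServer
open Function

theorem sum_update_add {ι β : Type*} [Fintype ι] [DecidableEq ι] (φ : β → ℝ) (G : ι → β) (s : ι)
    (a : β) : ∑ u, φ (update G s a u) + φ (G s) = ∑ u, φ (G u) + φ a := by
  rw [← Finset.add_sum_erase _ _ (Finset.mem_univ s),
    ← Finset.add_sum_erase Finset.univ (fun u => φ (G u)) (Finset.mem_univ s)]
  have : ∑ t ∈ Finset.univ.erase s, φ (update G s a t) = ∑ t ∈ Finset.univ.erase s, φ (G t) :=
    Finset.sum_congr rfl fun t ht => by rw [update_of_ne (Finset.ne_of_mem_erase ht)]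
  rw [this, update_self]
  ring

section Algorithm

variable {V : Type*} {k : ℕ}

/-- A configuration in which each server carries a tag: the hub on the way to its next request,
or `none` if it has no further request. -/
abbrev Tagged (V : Type*) (k : ℕ) : Type _ := Fin k → V × Option V

/-- What the algorithm knows: the positions of the servers and some of the tags. -/
abbrev Knowledge (V : Type*) (k : ℕ) : Type _ := Fin k → V × Option (Option V)

/-- The knowledge when the tags of the servers in `R` are known. -/
def Tagged.restrict (G : Tagged V k) (R : Finset (Fin k)) : Knowledge V k :=
  fun s => ((G s).1, if s ∈ R then some (G s).2 else none)

theorem Tagged.restrict_insert (G : Tagged V k) (R : Finset (Fin k)) (t : Fin k) :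
    update (G.restrict R) t ((G t).1, some (G t).2) = G.restrict (insert t R) := by
  funext s
  by_cases h : s = t
  · subst h
    simp [restrict]
  · simp [restrict, h]

theorem Tagged.restrict_update (G : Tagged V k) {R : Finset (Fin k)} {t : Fin k} (ht : t ∈ R)
    (x : V) (o : Option V) :
    update (G.restrict R) t (x, some o) = Tagged.restrict (update G t (x, o)) R := by
  funext s
  by_cases h : s = t
  · subst h
    simp [restrict, ht]
  · simp [restrict, h]

open Classical in
/-- As long as no server is known to have the tag `v`, the tag of the unknown server nearest to `v`
is read. The computation goes on with a server that has the tag `v`. -/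
noncomputable def reveal (d : V → V → ℝ) (b : ℕ) (dec : V → List Bool → Option V) (v : V)
    (g : Knowledge V k → Fin k → Reader (Knowledge V k)) :
    ℕ → Knowledge V k → Reader (Knowledge V k)
  -- With the advice used below neither this exit nor the last one is reached: the fuel `k + 1`
  -- exceeds the number of unknown tags, and a server with tag `v` exists.
  | 0, x => .done x
  | n + 1, x =>
    if h : ∃ s, (x s).2 = some (some v) then g x h.choose
    else if h : ∃ t, (x t).2 = none ∧ ∀ u, (x u).2 = none →
        toLex (d (x t).1 v, t) ≤ toLex (d (x u).1 v, u) then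
      .block b fun l =>
        reveal d b dec v g n (update x h.choose ((x h.choose).1, some (dec (x h.choose).1 l)))
    else .done x

/-- Serving the request `r`: read the tag of the server to be used, find such a server, move it and
read its new tag. -/
noncomputable def serve (d : V → V → ℝ) (b : ℕ) (dec : V → List Bool → Option V) (r : V)
    (x : Knowledge V k) : Reader (Knowledge V k) :=
  .block b fun l =>
    match dec r l with
    | none => .done x
    | some v => reveal d b dec v
        (fun x s => .block b fun l => .done (update x s (r, some (dec r l)))) (k + 1) x

variable {d : V → V → ℝ} {b : ℕ} {enc : V → Option V → List Bool} {dec : V → List Bool → Option V}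

/-- As long as a server with tag `v` is unknown, it precedes every unknown server outside `U`, so
the nearest unknown server lies in `U`. Thus codes are spent only on `U`, one for each new element
of the known set. -/
theorem eval_reveal (hlen : ∀ x o, (enc x o).length = b) (G : Tagged V k)
    (hdec : ∀ s, dec (G s).1 (enc (G s).1 (G s).2) = (G s).2) {v : V} {U : Finset (Fin k)}
    (hs : ∃ s, (G s).2 = some v) (g : Knowledge V k → Fin k → Reader (Knowledge V k)) (n : ℕ) :
    ∀ R : Finset (Fin k), R ⊆ U → Rᶜ.card < n →
      (∀ s ∉ R, ∀ t ∉ R, t ∉ U → (G s).2 = some v →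
        toLex (d (G s).1 v, s) < toLex (d (G t).1 v, t)) →
      ∃ (R' : Finset (Fin k)) (s' : Fin k) (seg : List Bool), R ⊆ R' ∧ R' ⊆ U ∧ s' ∈ R' ∧
        (G s').2 = some v ∧ seg.length + b * R.card = b * R'.card ∧
        ∀ rest, (reveal d b dec v g n (G.restrict R)).eval (seg ++ rest) =
          (g (G.restrict R') s').eval rest := by
  induction n with
  | zero => intro R _ h; omega
  | succ n ih =>
    intro R hRU hn hU
    by_cases h1 : ∃ s, ((G.restrict R) s).2 = some (some v)
    · have hmem : ∀ u, ((G.restrict R) u).2 = some (some v) → u ∈ R ∧ (G u).2 = some v := by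
        intro u h
        simp only [Tagged.restrict] at h
        split_ifs at h with hR
        exact ⟨hR, Option.some_inj.1 h⟩
      replace hmem := hmem _ h1.choose_spec
      refine ⟨R, h1.choose, [], subset_rfl, hRU, hmem.1, hmem.2, by simp, fun rest => ?_⟩
      rw [reveal, dif_pos h1, List.nil_append]
    · have hunk : ∀ s, ((G.restrict R) s).2 = none ↔ s ∉ R := by
        intro s
        simp [Tagged.restrict]
      obtain ⟨s, hs⟩ := hs
      have hsR : s ∉ R := fun h => h1 ⟨s, by simp [Tagged.restrict, h, hs]⟩
      have h2 : ∃ t, ((G.restrict R) t).2 = none ∧ ∀ u, ((G.restrict R) u).2 = none →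
          toLex (d ((G.restrict R) t).1 v, t) ≤ toLex (d ((G.restrict R) u).1 v, u) := by
        obtain ⟨t, ht, hmin⟩ := Finset.exists_min_image Rᶜ (fun u => toLex (d (G u).1 v, u))
          ⟨s, by simpa using hsR⟩
        refine ⟨t, (hunk t).2 (by simpa using ht), fun u hu => hmin u ?_⟩
        simpa using (hunk u).1 hu
      obtain ⟨t, ht⟩ : ∃ t, t = h2.choose := ⟨_, rfl⟩
      have htspec := h2.choose_spec
      rw [← ht] at htspec
      have htR := (hunk t).1 htspec.1
      have htU : t ∈ U := by
        by_contra htU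
        exact absurd (hU s hsR t htR htU hs) (not_lt.2 (htspec.2 s ((hunk s).2 hsR)))
      have hcard : (insert t R)ᶜ.card < n := by
        have h3 : (insert t R).card = R.card + 1 := Finset.card_insert_of_notMem htR
        have h4 := Finset.card_compl_add_card R
        have h5 := Finset.card_compl_add_card (insert t R)
        omega
      obtain ⟨R', s', seg, hR, hRU', hs', hv, hseg, heval⟩ := ih (insert t R)
        (Finset.insert_subset htU hRU) hcard (fun s hs t ht => hU s (fun h => hs (by simp [h])) t
          (fun h => ht (by simp [h])))
      refine ⟨R', s', enc (G t).1 (G t).2 ++ seg, (Finset.subset_insert _ _).trans hR, hRU', hs',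
        hv, ?_, fun rest => ?_⟩
      · rw [Finset.card_insert_of_notMem htR] at hseg
        rw [List.length_append, hlen, ← hseg]
        ring
      · rw [reveal, dif_neg h1, dif_pos h2, ← ht, List.append_assoc]
        have hb := hlen (G t).1 (G t).2
        subst hb
        rw [Reader.eval_block]
        have : ((G.restrict R) t).1 = (G t).1 := rfl
        rw [this, hdec, Tagged.restrict_insert]
        exact heval rest

/-- The distance from a server to the hub that it is tagged with. -/
def tagDist (d : V → V → ℝ) : V × Option V → ℝ
  | (_, none) => 0
  | (x, some v) => d x v

/-- The tags for the assignment `l` of requests to servers in the configuration `P`. -/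
def tagged (hub : V → V → V) (P : Fin k → V) (l : List (V × Fin k)) : Tagged V k :=
  fun s => (P s, (nextRequest s l).map (hub (P s)))

theorem tagged_cons (hub : V → V → V) (P : Fin k → V) (r : V) (s : Fin k) (l : List (V × Fin k)) :
    tagged hub (update P s r) l =
      update (tagged hub P ((r, s) :: l)) s (r, (nextRequest s l).map (hub r)) := by
  funext t
  by_cases h : t = s
  · subst h
    simp [tagged]
  · simp [tagged, h, nextRequest_cons_of_ne]

/-- The invariant of the algorithm: here `x` is its knowledge, `l` are the requests that are left
with their servers in an optimal solution, `β` is the number of bits that have been read and `γ` is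
the cost so far. -/
def Invariant (d : V → V → ℝ) (hub : V → V → V) (H : V → Finset V) (b : ℕ) (U : Finset (Fin k))
    (G₀ : Tagged V k) (n : ℕ) (K : ℝ) (l : List (V × Fin k)) (x : Knowledge V k) (β : ℕ) (γ : ℝ) :
    Prop :=
  ∃ (G : Tagged V k) (R : Finset (Fin k)) (P : Fin k → V) (e : Equiv.Perm (Fin k)),
    x = G.restrict R ∧ R ⊆ U ∧ β + 2 * b * l.length ≤ b * (2 * n + R.card) ∧
    (∀ s ∉ R, G s = G₀ s) ∧ (∀ s v, (G s).2 = some v → v ∈ H (G s).1) ∧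
    (∀ s, (G s).2 = (tagged hub P l (e s)).2) ∧
    γ + ∑ s, tagDist d (G s) + lazyCost d P l ≤ K + ∑ s, tagDist d (tagged hub P l s)

variable {hub : V → V → V} {H : V → Finset V} {U : Finset (Fin k)} {G₀ : Tagged V k} {n : ℕ} {K : ℝ}

/-- The permutation in the invariant matches the servers of the algorithm with servers of the
optimum that have the same tags; their positions may differ. Unrevealed servers have never moved, so
`hU`, which concerns the initial configuration only, still governs the search. -/
theorem Invariant.exists_step (hself : ∀ x, d x x = 0) (htri : ∀ x y z, d x z ≤ d x y + d y z)
    (hlen : ∀ x o, (enc x o).length = b)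
    (hdec : ∀ x o, (∀ v, o = some v → v ∈ H x) → dec x (enc x o) = o)
    (hub_left : ∀ x y, hub x y ∈ H x) (hub_right : ∀ x y, hub x y ∈ H y)
    (hub_dist : ∀ x y, d x (hub x y) + d (hub x y) y = d x y)
    (hU : ∀ s t v, t ∉ U → (G₀ s).2 = some v →
      toLex (d (G₀ s).1 v, s) < toLex (d (G₀ t).1 v, t))
    {r : V} {s : Fin k} {l : List (V × Fin k)} {x : Knowledge V k} {β : ℕ} {γ : ℝ}
    (h : Invariant d hub H b U G₀ n K ((r, s) :: l) x β γ) :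
    ∃ (x' : Knowledge V k) (seg : List Bool),
      (serve d b dec r x).eval seg = some (x', []) ∧ (∃ s', (x' s').1 = r) ∧
      Invariant d hub H b U G₀ n K l x' (β + seg.length) (γ + ∑ u, d (x u).1 (x' u).1) := by
  obtain ⟨G, R, P, e, rfl, hRU, hβ, hG₀, hGH, he, hγ⟩ := h
  set F := tagged hub P ((r, s) :: l) with hF
  set v := hub (P s) r with hv
  have hFs : F s = (P s, some v) := by simp [hF, tagged, nextRequest_cons_self, hv]
  set o := (nextRequest s l).map (hub r) with ho
  have hoH : ∀ u, o = some u → u ∈ H r := by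
    intro u hu
    rw [ho, Option.map_eq_some_iff] at hu
    obtain ⟨a, -, rfl⟩ := hu
    exact hub_left _ _
  have hGs : ∃ s, (G s).2 = some v := ⟨e.symm s, by rw [he, e.apply_symm_apply, hFs]⟩
  obtain ⟨R', s', seg, hRR', hRU', hs', hGv, hseg, heval⟩ :=
    eval_reveal (d := d) hlen G (fun s => hdec _ _ (hGH s)) (U := U) hGs
      (fun x s => .block b fun l => .done (update x s (r, some (dec r l)))) (k + 1) R hRU
      (Nat.lt_succ_of_le (by simpa using Finset.card_le_univ Rᶜ))
      (fun s hs t ht htU hsv => by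
        rw [hG₀ s hs] at hsv ⊢
        rw [hG₀ t ht]
        exact hU s t v htU hsv)
  -- The algorithm moves `s'` and the optimum moves `s`, so the matching is changed by a swap: the
  -- former partner of `s` gets that of `s'`, and both carry the tag `v`.
  refine ⟨Tagged.restrict (update G s' (r, o)) R', enc r (some v) ++ (seg ++ enc r o), ?_,
    ⟨s', by simp [Tagged.restrict]⟩, update G s' (r, o), R', update P s r,
    e.trans (Equiv.swap (e s') s), rfl, hRU', ?_, ?_, ?_, ?_, ?_⟩
  · have hdv := hdec r (some v) (by rintro _ ⟨⟩; exact hub_right _ _)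
    have hb := hlen r (some v)
    have e1 : (serve d b dec r (G.restrict R)).eval (enc r (some v) ++ (seg ++ enc r o)) =
        (reveal d b dec v (fun x s => .block b fun l => .done (update x s (r, some (dec r l))))
          (k + 1) (G.restrict R)).eval (seg ++ enc r o) := by
      rw [serve]
      conv_lhs => rw [show b = (enc r (some v)).length from hb.symm]
      rw [Reader.eval_block, hdv, hb]
    rw [e1, heval]
    have e2 := Reader.eval_block (fun l => Reader.done (update (G.restrict R') s' (r, some (dec r l))))
      (enc r o) []
    rw [hlen, List.append_nil] at e2
    rw [e2, hdec r o hoH, Tagged.restrict_update _ hs']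
    rfl
  · simp only [List.length_append, hlen, List.length_cons] at hβ ⊢
    nlinarith
  · intro u hu
    rw [update_of_ne (by rintro rfl; exact hu hs'), hG₀ u fun h => hu (hRR' h)]
  · intro u w hw
    by_cases h : u = s'
    · subst h
      simp only [update_self] at hw ⊢
      exact hoH w hw
    · rw [update_of_ne h] at hw ⊢
      exact hGH u w hw
  · intro u
    rw [tagged_cons, ← hF, ← ho]
    by_cases h : u = s'
    · subst h
      simp
    · rw [update_of_ne h, Equiv.trans_apply]
      have hne : e u ≠ e s' := fun h' => h (e.injective h')
      by_cases h' : e u = s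
      · rw [h', Equiv.swap_apply_right, update_of_ne (h' ▸ hne.symm), ← he s', hGv, he, h', hFs]
      · rw [Equiv.swap_apply_of_ne_of_ne hne h', update_of_ne h', he]
  · have h1 := sum_update_add (tagDist d) G s' (r, o)
    have h2 := sum_update_add (tagDist d) F s (r, o)
    have h3 : ∑ u, d ((G.restrict R) u).1 (Tagged.restrict (update G s' (r, o)) R' u).1 =
        d (G s').1 r := by
      rw [Finset.sum_eq_single s']
      · simp [Tagged.restrict]
      · intro u _ hu
        simp [Tagged.restrict, hu, hself]
      · simp
    have h4 : tagDist d (G s') = d (G s').1 v := by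
      rw [← Prod.mk.eta (p := G s'), hGv, tagDist]
    rw [hFs, tagDist] at h2
    rw [h4] at h1
    rw [h3, tagged_cons, ← hF, ← ho]
    rw [lazyCost] at hγ
    have h5 := htri (G s').1 v r
    have h6 := hub_dist (P s) r
    simp only at hγ
    linarith

theorem Invariant.exists_states (hself : ∀ x, d x x = 0) (htri : ∀ x y z, d x z ≤ d x y + d y z)
    (hlen : ∀ x o, (enc x o).length = b)
    (hdec : ∀ x o, (∀ v, o = some v → v ∈ H x) → dec x (enc x o) = o)
    (hub_left : ∀ x y, hub x y ∈ H x) (hub_right : ∀ x y, hub x y ∈ H y)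
    (hub_dist : ∀ x y, d x (hub x y) + d (hub x y) y = d x y)
    (hU : ∀ s t v, t ∉ U → (G₀ s).2 = some v →
      toLex (d (G₀ s).1 v, s) < toLex (d (G₀ t).1 v, t))
    (l : List (V × Fin k)) : ∀ (x : Knowledge V k) (β : ℕ) (γ : ℝ),
      Invariant d hub H b U G₀ n K l x β γ →
      ∃ (st : ℕ → Knowledge V k) (seg : ℕ → List Bool), st 0 = x ∧
        (∀ (i : ℕ) (hi : i < l.length),
          (serve d b dec l[i].1 (st i)).eval (seg i) = some (st (i + 1), []) ∧
            ∃ s, (st (i + 1) s).1 = l[i].1) ∧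
        Invariant d hub H b U G₀ n K [] (st l.length)
          (β + ∑ i ∈ Finset.range l.length, (seg i).length)
          (γ + ∑ i ∈ Finset.range l.length, ∑ s, d (st i s).1 (st (i + 1) s).1) := by
  induction l with
  | nil =>
    intro x β γ h
    exact ⟨fun _ => x, fun _ => [], rfl, fun i hi => absurd hi (by simp), by simpa using h⟩
  | cons a l ih =>
    intro x β γ h
    obtain ⟨r, s⟩ := a
    obtain ⟨x', sg, heval, hr, hinv⟩ := h.exists_step hself htri hlen hdec hub_left hub_right
      hub_dist hU
    obtain ⟨st, seg, h0, hstep, hend⟩ := ih _ _ _ hinv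
    refine ⟨fun i => Nat.casesOn i x st, fun i => Nat.casesOn i sg seg, rfl, ?_, ?_⟩
    · rintro (_ | i) hi
      · simp only [List.getElem_cons_zero]
        rw [h0]
        exact ⟨heval, hr⟩
      · exact hstep i (by simpa using hi)
    · rw [List.length_cons, Finset.sum_range_succ', Finset.sum_range_succ']
      simp only [h0]
      convert hend using 1
      · show β + (_ + sg.length) = _
        ring
      · show γ + (_ + ∑ u, d (x u).1 (x' u).1) = _
        ring

/-- If geodesics pass through hubs, a constant number of codes of hubs per request is enough advice
for optimality. -/
theorem exists_onlineAlgorithm [Finite V] (hnonneg : ∀ x y, 0 ≤ d x y) (hself : ∀ x, d x x = 0)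
    (htri : ∀ x y z, d x z ≤ d x y + d y z) (hb : ∀ x, (H x).card + 1 ≤ 2 ^ b)
    (hH : ∀ x y, ∃ v, v ∈ H x ∧ v ∈ H y ∧ d x v + d v y = d x y) (hk : 0 < k) (init : Fin k → V) :
    ∃ A : OnlineAlgorithm V k, ∀ σ : List V, ∃ (B : ℕ → Bool) (c : Schedule V k) (p : ℕ → ℕ),
      A.Run init B σ c p ∧ Serves init σ c ∧
      (∀ c', Serves init σ c' → ∑ i ∈ Finset.range σ.length, ∑ s, d (c i s) (c (i + 1) s) ≤
        ∑ i ∈ Finset.range σ.length, ∑ s, d (c' i s) (c' (i + 1) s)) ∧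
      p σ.length ≤ 3 * b * σ.length := by
  choose enc dec hlen hdec using fun x => exists_code (H x) (hb x)
  choose hub hub_left hub_right hub_dist using hH
  refine ⟨onlineAlgorithm (serve d b dec) (fun s => (init s, none)) (fun x s => (x s).1), fun σ => ?_⟩
  obtain ⟨l, rfl, hl⟩ := exists_lexOptimal hk d init σ
  set G₀ := tagged hub init l with hG₀
  set U : Finset (Fin k) := Finset.univ.filter fun s => nextRequest s l ≠ none with hUdef
  have hU : ∀ s t v, t ∉ U → (G₀ s).2 = some v →
      toLex (d (G₀ s).1 v, s) < toLex (d (G₀ t).1 v, t) := by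
    intro s t v ht hs
    simp only [hG₀, tagged, Option.map_eq_some_iff] at hs
    obtain ⟨r, hr, rfl⟩ := hs
    exact hl.lt_of_unused htri hr (by simpa [hUdef] using ht) (hub_dist _ _)
  have hUcard : U.card ≤ l.length := by
    have : U ⊆ (l.map Prod.snd).toFinset := by
      intro s hs
      simp only [hUdef, Finset.mem_filter, Finset.mem_univ, true_and, ne_eq, nextRequest_eq_none] at hs
      push Not at hs
      obtain ⟨a, ha, has⟩ := hs
      simp only [List.mem_toFinset, List.mem_map]
      exact ⟨a, ha, has⟩
    refine (Finset.card_le_card this).trans ((List.toFinset_card_le _).trans ?_)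
    simp
  -- At the start both configurations coincide, so the potentials cancel. At the end that of the
  -- optimum vanishes and that of the algorithm is nonnegative.
  have hinit : Invariant d hub H b U G₀ l.length (lazyCost d init l) l (fun s => (init s, none)) 0 0 := by
    refine ⟨G₀, ∅, init, Equiv.refl _, ?_, by simp, by simp; ring_nf; rfl, by simp, ?_, by simp [hG₀], ?_⟩
    · funext s
      simp [Tagged.restrict, hG₀, tagged]
    · intro s v hs
      simp only [hG₀, tagged, Option.map_eq_some_iff] at hs
      obtain ⟨r, hr, rfl⟩ := hs
      exact hub_left _ _
    · rw [← hG₀]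
      linarith
  obtain ⟨st, seg, h0, hstep, G, R, P, e, -, hRU, hbits, -, -, -, hcost⟩ :=
    hinit.exists_states hself htri hlen hdec hub_left hub_right hub_dist hU
  obtain ⟨B, p, hrun, hp⟩ := exists_run (serve d b dec) (fun s => (init s, none))
    (fun (x : Knowledge V k) s => (x s).1) (l.map Prod.fst) st seg h0 (by
      intro i hi
      simp only [List.getElem_map]
      exact (hstep i (by simpa using hi)).1)
  refine ⟨B, _, p, hrun, ⟨by simp [h0], fun i hi => ?_⟩, fun c' hc' => ?_, ?_⟩
  · simp only [List.getElem_map]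
    exact (hstep i (by simpa using hi)).2
  · obtain ⟨l', hl', hle⟩ := exists_lazyCost_le hnonneg hself htri _ c' hc'.2 init
    have h1 := hl l' hl'
    have h2 : lazyCost d init l ≤ lazyCost d init l' := by
      rw [Prod.Lex.toLex_le_toLex] at h1
      exact h1.elim le_of_lt fun h => h.1.le
    have h3 : ∑ s, d (init s) (c' 0 s) = 0 := by simp [hc'.1, hself]
    have h4 : ∑ s, tagDist d (tagged hub P [] s) = 0 := by simp [tagged, nextRequest, tagDist]
    have h5 : 0 ≤ ∑ s, tagDist d (G s) := by
      refine Finset.sum_nonneg fun s _ => ?_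
      rcases G s with ⟨x, _ | v⟩
      · exact le_rfl
      · exact hnonneg x v
    rw [h4, lazyCost] at hcost
    rw [h3] at hle
    rw [List.length_map] at hle ⊢
    linarith
  · rw [hp, List.length_map]
    have h1 := Finset.card_le_card hRU
    have h2 : b * R.card ≤ b * l.length := Nat.mul_le_mul_left _ (h1.trans hUcard)
    simp only [List.length_nil] at hbits
    nlinarith

end Algorithm

end KServer

/-! ### Degenerate case and numerical estimate -/

namespace KServer

/-- A single server has no choice, so it needs no advice. -/
theorem exists_onlineAlgorithm_of_one_server {V : Type*} (G : SimpleGraph V) (w : Sym2 V → ℝ)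
    (init : Fin 1 → V) :
    ∃ A : OnlineAlgorithm V 1, ∀ σ : List V, ∃ (B : ℕ → Bool) (c : Schedule V 1) (p : ℕ → ℕ),
      A.Run init B σ c p ∧ ServesOptimally G w init σ c ∧ p σ.length = 0 := by
  refine ⟨fun σ _ => some fun _ => σ.getLastD (init 0), fun σ => ?_⟩
  have hc : ∀ (i : ℕ) (hi : i < σ.length), (σ.take (i + 1)).getLastD (init 0) = σ[i] := by
    intro i hi
    rw [← List.take_concat_get' σ i hi, List.getLastD_concat]
  refine ⟨fun _ => false, fun i _ => (σ.take i).getLastD (init 0), fun _ => 0, ⟨?_, rfl, ?_⟩,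
    ⟨⟨?_, fun i hi => ⟨0, hc i hi⟩⟩, fun c' hc' => le_of_eq ?_⟩, rfl⟩
  · funext s
    simp [Subsingleton.elim s 0]
  · exact fun i _ => ⟨le_rfl, fun q _ hq => absurd hq (Nat.not_lt_zero q), rfl⟩
  · funext s
    simp [Subsingleton.elim s 0]
  · have h : ∀ i ≤ σ.length, (fun _ : Fin 1 => (σ.take i).getLastD (init 0)) = c' i := by
      intro i hi
      funext s
      rcases i with _ | i
      · simp [hc'.1, Subsingleton.elim s 0]
      · obtain ⟨t, ht⟩ := hc'.2 i hi
        rw [hc i hi, Subsingleton.elim s t, ht]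
    refine Finset.sum_congr rfl fun i hi => ?_
    rw [Finset.mem_range] at hi
    rw [← h i hi.le, ← h (i + 1) hi]

/-- The length of the codes is of the order that the theorem claims. -/
theorem clog_hubs_le {N a : ℕ} (hN : 3 ≤ N) (ha : 1 ≤ a) :
    (Nat.clog 2 ((Nat.log 2 N + 1) * (a + 1) + 1) : ℝ) ≤
      10 * (Real.logb 2 a + Real.logb 2 (Real.logb 2 N)) := by
  set L := Real.logb 2 N with hL
  have hN' : (3 : ℝ) ≤ N := by exact_mod_cast hN
  have ha' : (1 : ℝ) ≤ a := by exact_mod_cast ha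
  have hL3 : (3 / 2 : ℝ) ≤ L := by
    rw [hL, Real.le_logb_iff_rpow_le one_lt_two (by linarith)]
    refine le_trans ?_ hN'
    rw [← Real.sqrt_sq (show (0 : ℝ) ≤ 3 by norm_num)]
    apply Real.le_sqrt_of_sq_le
    rw [← Real.rpow_natCast, ← Real.rpow_mul (by norm_num)]
    norm_num
  -- For `N ≥ 3` this positive lower bound absorbs the additive 4 that arises below: 3 from the
  -- factor 2³ and 1 from rounding up.
  have hlogL : (1 / 2 : ℝ) ≤ Real.logb 2 L := by
    rw [Real.le_logb_iff_rpow_le one_lt_two (by linarith)]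
    refine le_trans ?_ hL3
    rw [← Real.sqrt_eq_rpow]
    rw [Real.sqrt_le_left (by norm_num)]
    norm_num
  have hlog : (Nat.log 2 N : ℝ) ≤ L := Real.natLog_le_logb N 2
  have hloga : 0 ≤ Real.logb 2 a := Real.logb_nonneg one_lt_two ha'
  set m := (Nat.log 2 N + 1) * (a + 1) + 1 with hm
  have hm1 : (m : ℝ) ≤ 2 ^ 3 * (a * L) := by
    rw [hm]
    push_cast
    have h1 : ((Nat.log 2 N : ℝ) + 1) ≤ 2 * L := by linarith
    have h2 : ((a : ℝ) + 1) ≤ 2 * a := by linarith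
    have h3 : ((Nat.log 2 N : ℝ) + 1) * (a + 1) ≤ (2 * L) * (2 * a) :=
      mul_le_mul h1 h2 (by linarith) (by linarith)
    have h4 : 1 * (3 / 2) ≤ a * L := mul_le_mul ha' hL3 (by norm_num) (by linarith)
    linarith
  have hm0 : (0 : ℝ) < m := by positivity
  have h1 : (Nat.clog 2 m : ℝ) ≤ Real.logb 2 m + 1 := by
    have h2 : Nat.clog 2 m = ⌈Real.logb 2 m⌉₊ := (Real.natCeil_logb_natCast 2 m).symm
    rw [h2]
    have : 0 ≤ Real.logb 2 m := Real.logb_nonneg one_lt_two (by exact_mod_cast (by omega : 1 ≤ m))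
    exact (Nat.ceil_lt_add_one this).le
  have h2 : Real.logb 2 m ≤ 3 + (Real.logb 2 a + Real.logb 2 L) := by
    have h3 : Real.logb 2 ((2 : ℝ) ^ 3 * (a * L)) = 3 + (Real.logb 2 a + Real.logb 2 L) := by
      rw [Real.logb_mul (by norm_num) (by positivity), Real.logb_mul (by positivity) (by positivity),
        Real.logb_pow, Real.logb_self_eq_one one_lt_two]
      norm_num
    rw [← h3]
    exact Real.logb_le_logb_of_le one_lt_two hm0 hm1
  linarith

end KServer

theorem mainTheorem3 :
    ∃ C : ℝ, ∀ (V : Type*) [Fintype V] (G : SimpleGraph V) (w : Sym2 V → ℝ),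
      G.Connected → (∀ e ∈ G.edgeSet, 0 < w e) →
      ∀ (k : ℕ) (init : Fin k → V), 0 < k → k < Fintype.card V →
        ∃ A : KServer.OnlineAlgorithm V k, ∀ σ : List V,
          ∃ (B : ℕ → Bool) (c : KServer.Schedule V k) (p : ℕ → ℕ),
            KServer.OnlineAlgorithm.Run A init B σ c p ∧
            KServer.ServesOptimally G w init σ c ∧
            (p σ.length : ℝ) ≤ C * σ.length *
              (Real.logb 2 (KServer.treewidth G) +
                Real.logb 2 (Real.logb 2 (Fintype.card V))) := by
  -- At most three codes per request, each of length at most 10 (log₂ α + log₂ log₂ N).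
  refine ⟨30, fun V _ G w hG hw k init hk hkV => ?_⟩
  have ha := KServer.one_le_treewidth hG (by omega)
  by_cases hN : 3 ≤ Fintype.card V
  · have := hG.nonempty
    have hlog := KServer.clog_hubs_le hN ha
    obtain ⟨H, hcard, hH⟩ := KServer.exists_hubs G
    set b := Nat.clog 2 ((Nat.log 2 (Fintype.card V) + 1) * (KServer.treewidth G + 1) + 1)
    obtain ⟨A, hA⟩ := KServer.exists_onlineAlgorithm (b := b) (KServer.wdist_nonneg hw)
      (KServer.wdist_self hw) (KServer.wdist_triangle hG hw)
      (fun x => (Nat.add_le_add_right (hcard x) 1).trans (Nat.le_pow_clog one_lt_two _))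
      (KServer.exists_hub_on_geodesic hG hw hH) hk init
    refine ⟨A, fun σ => ?_⟩
    obtain ⟨B, c, p, hrun, hserves, hopt, hp⟩ := hA σ
    refine ⟨B, c, p, hrun, ⟨hserves, hopt⟩, ?_⟩
    have hp' : (p σ.length : ℝ) ≤ 3 * b * σ.length := by exact_mod_cast hp
    have := mul_le_mul_of_nonneg_right hlog (Nat.cast_nonneg (α := ℝ) σ.length)
    linarith
  -- On two vertices log₂ log₂ N = 0 and the treewidth is 1, so the bound leaves no bits at all; but
  -- there is just one server.
  · obtain rfl : k = 1 := by omega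
    obtain ⟨A, hA⟩ := KServer.exists_onlineAlgorithm_of_one_server G w init
    refine ⟨A, fun σ => ?_⟩
    obtain ⟨B, c, p, hrun, hopt, hp⟩ := hA σ
    refine ⟨B, c, p, hrun, hopt, ?_⟩
    have hV : (Fintype.card V : ℝ) = 2 := by exact_mod_cast (by omega : Fintype.card V = 2)
    have hlog : 0 ≤ Real.logb 2 (KServer.treewidth G : ℝ) :=
      Real.logb_nonneg one_lt_two (by exact_mod_cast ha)
    rw [hp, hV, Real.logb_self_eq_one one_lt_two, Real.logb_one]
    simp only [Nat.cast_zero, add_zero]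
    positivity
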